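/- Let $(M, \eta, \xi, \phi, g)$ be a 3-dimensional contact metric manifold: $M$ is a (non-empty) smooth 3-manifold with a smooth Riemannian metric $g$, $\eta$ is a smooth 1-form with $\eta\wedge d\eta\neq 0$ everywhere, $\xi$ is its characteristic vector field ($\eta(\xi)=1$ and $d\eta(\xi,X)=0$ for all $X$), and $\phi$ is a smooth $(1,1)$-tensor field such that $$\eta(X)=g(X,\xi),\qquad d\eta(X,Y)=g(X,\phi Y),\qquad \phi^2X=-X+\eta(X)\xi$$ for all vector fields $X,Y$, where $2\,d\eta(X,Y)=X\eta(Y)-Y\eta(X)-\eta([X,Y])$. Let $\nabla$ be the Levi-Civita connection of $g$ and $R(X,Y)Z=\nabla_X\nabla_YZ-\nabla_Y\nabla_XZ-\nabla_{[X,Y]}Z$ its curvature. The structure is called an $N(k)$-contact metric structure, where $k\in\mathbb{R}$ is a constant, if $R(X,Y)\xi=k\,[g(Y,\xi)X-g(X,\xi)Y]$ for all $X,Y$, and $\phi$-recurrent if there is a smooth 1-form $A$, not identically zero, such that $$\phi^2\big((\nabla_WR)(X,Y)Z\big)=A(W)\,R(X,Y)Z$$ for all vector fields $X,Y,Z,W$.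 Then $(M,\eta,\xi,\phi,g)$ is a $\phi$-recurrent $N(k)$-contact metric manifold for some constant $k$ if and only if $g$ is flat, i.e. $R=0$. -/

import Mathlib

open Bundle VectorField
open scoped Manifold ContDiff

noncomputable section LeviCivita

theorem finiteDimensional_tangentSpace {E : Type*} [NormedAddCommGroup E] [NormedSpace ℝ E]
    [FiniteDimensional ℝ E] {H : Type*} [TopologicalSpace H] (I : ModelWithCorners ℝ E H)
    {M : Type*} [TopologicalSpace M] [ChartedSpace H M] (x : M) :
    FiniteDimensional ℝ (TangentSpace I x) :=
  inferInstanceAs (FiniteDimensional ℝ E)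

variable {E : Type*} [NormedAddCommGroup E] [NormedSpace ℝ E] [FiniteDimensional ℝ E]
  {H : Type*} [TopologicalSpace H] (I : ModelWithCorners ℝ E H)
  {M : Type*} [TopologicalSpace M] [ChartedSpace H M] [IsManifold I ∞ M]
  [RiemannianBundle (fun x : M ↦ TangentSpace I x)]

/-- The expression that the Koszul formula assigns to `g(∇_X Y, Z)` at `x`. -/
def koszul (X Y Z : Π x : M, TangentSpace I x) (x : M) : ℝ :=
  (1 / 2) * (d% (fun y ↦ inner ℝ (Y y) (Z y)) x (X x)
    + d% (fun y ↦ inner ℝ (Z y) (X y)) x (Y x)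
    - d% (fun y ↦ inner ℝ (X y) (Y y)) x (Z x)
    - inner ℝ (X x) (mlieBracket I Y Z x)
    - inner ℝ (Y x) (mlieBracket I X Z x)
    + inner ℝ (Z x) (mlieBracket I X Y x))

variable [IsContMDiffRiemannianBundle I ∞ E (fun x : M ↦ TangentSpace I x)]

theorem mdiffAt_metric {X Y : Π x : M, TangentSpace I x} {x : M}
    (hX : MDiffAt (T% X) x) (hY : MDiffAt (T% Y) x) :
    MDiffAt (fun y ↦ inner ℝ (X y) (Y y)) x :=
  MDifferentiableAt.inner_bundle (F := E) (E := fun x : M ↦ TangentSpace I x) hX hY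

theorem koszul_tensorial_left {Y Z : Π x : M, TangentSpace I x} {x : M}
    (hY : MDiffAt (T% Y) x) (hZ : MDiffAt (T% Z) x) :
    TensorialAt I E (fun X : Π x : M, TangentSpace I x ↦ koszul I X Y Z x) x where
  smul {f X} hf hX := by
    simp [koszul, inner_smul_left, inner_smul_right, mvfderiv_fun_mul hf (mdiffAt_metric I hZ hX),
      mvfderiv_fun_mul hf (mdiffAt_metric I hX hY), mlieBracket_smul_left hf hX, inner_add_right]
    rw [real_inner_comm (X x) (Z x), real_inner_comm (X x) (Y x)]
    ring
  add {X X'} hX hX' := by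
    simp [koszul, mvfderiv_fun_add (mdiffAt_metric I hZ hX) (mdiffAt_metric I hZ hX'),
      mvfderiv_fun_add (mdiffAt_metric I hX hY) (mdiffAt_metric I hX' hY),
      mlieBracket_add_left hX hX', inner_add_right, inner_add_left]
    ring

theorem koszul_tensorial_right {X Y : Π x : M, TangentSpace I x} {x : M}
    (hX : MDiffAt (T% X) x) (hY : MDiffAt (T% Y) x) :
    TensorialAt I E (fun Z : Π x : M, TangentSpace I x ↦ koszul I X Y Z x) x where
  smul {f Z} hf hZ := by
    simp [koszul, inner_smul_left, inner_smul_right, mvfderiv_fun_mul hf (mdiffAt_metric I hZ hX),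
      mvfderiv_fun_mul hf (mdiffAt_metric I hY hZ), mlieBracket_smul_right hf hZ, inner_add_right]
    rw [real_inner_comm (X x) (Z x)]
    ring
  add {Z Z'} hZ hZ' := by
    simp [koszul, mvfderiv_fun_add (mdiffAt_metric I hY hZ) (mdiffAt_metric I hY hZ'),
      mvfderiv_fun_add (mdiffAt_metric I hZ hX) (mdiffAt_metric I hZ' hX),
      mlieBracket_add_right hZ hZ', inner_add_right, inner_add_left]
    ring

/-- The bilinear form `(X, Z) ↦ koszul X Y Z` on the tangent space at `x`, for a vector field `Y`
that is differentiable at `x`. -/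
def koszulForm (Y : Π x : M, TangentSpace I x) (x : M) (hY : MDiffAt (T% Y) x) :
    TangentSpace I x →L[ℝ] TangentSpace I x →L[ℝ] ℝ :=
  TensorialAt.mkHom₂ (F := E) (F' := E) (fun X Z ↦ koszul I X Y Z x) x
    (fun _ hZ ↦ koszul_tensorial_left I hY hZ) (fun _ hX ↦ koszul_tensorial_right I hX hY)

open Classical in
/-- `leviCivitaFun I Y x v` is `∇_v Y` at `x`: the tangent vector that represents the linear form
`koszulForm I Y x v` with respect to the metric (written out in an orthonormal basis). -/
def leviCivitaFun (Y : Π x : M, TangentSpace I x) (x : M) :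
    TangentSpace I x →L[ℝ] TangentSpace I x :=
  haveI := finiteDimensional_tangentSpace I x
  if hY : MDiffAt (T% Y) x then
    ∑ i, ((koszulForm I Y x hY).flip (stdOrthonormalBasis ℝ (TangentSpace I x) i)).smulRight
      (stdOrthonormalBasis ℝ (TangentSpace I x) i)
  else 0

theorem inner_leviCivitaFun {X Y Z : Π x : M, TangentSpace I x} {x : M}
    (hX : MDiffAt (T% X) x) (hY : MDiffAt (T% Y) x) (hZ : MDiffAt (T% Z) x) :
    inner ℝ (leviCivitaFun I Y x (X x)) (Z x) = koszul I X Y Z x := by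
  have := finiteDimensional_tangentSpace I x
  have key : koszulForm I Y x hY (X x) (Z x) = koszul I X Y Z x :=
    TensorialAt.mkHom₂_apply _ _ hX hZ
  rw [← key, leviCivitaFun, dif_pos hY]
  conv_rhs => rw [← (stdOrthonormalBasis ℝ (TangentSpace I x)).sum_repr' (Z x)]
  simp [sum_inner, inner_smul_left, mul_comm]

/-- Two endomorphisms of a tangent space agree if their matrix coefficients agree. -/
theorem tangent_hom_ext {x : M} {S T : TangentSpace I x →L[ℝ] TangentSpace I x}
    (h : ∀ X Z : Π x : M, TangentSpace I x, MDiffAt (T% X) x → MDiffAt (T% Z) x →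
      inner ℝ (S (X x)) (Z x) = inner ℝ (T (X x)) (Z x)) : S = T := by
  ext v
  refine ext_inner_right ℝ fun w ↦ ?_
  simpa using h (FiberBundle.extend E v) (FiberBundle.extend E w)
    (FiberBundle.mdifferentiableAt_extend ..) (FiberBundle.mdifferentiableAt_extend ..)

/-- The Levi-Civita connection of a Riemannian manifold. -/
def leviCivita : CovariantDerivative I E (fun x : M ↦ TangentSpace I x) where
  toFun := leviCivitaFun I
  isCovariantDerivativeOnUniv :=
    { add := by
        intro Y Y' x hY hY' _
        refine tangent_hom_ext I fun X Z hX hZ ↦ ?_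
        have hYY' : MDiffAt (T% (Y + Y')) x := mdifferentiableAt_add_section hY hY'
        rw [inner_leviCivitaFun I hX hYY' hZ, add_apply, inner_add_left,
          inner_leviCivitaFun I hX hY hZ, inner_leviCivitaFun I hX hY' hZ]
        simp [koszul, mvfderiv_fun_add (mdiffAt_metric I hY hZ) (mdiffAt_metric I hY' hZ),
          mvfderiv_fun_add (mdiffAt_metric I hX hY) (mdiffAt_metric I hX hY'),
          mlieBracket_add_left hY hY', mlieBracket_add_right hY hY',
          inner_add_right, inner_add_left]
        ring
      leibniz := by
        intro Y f x hY hf _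
        refine tangent_hom_ext I fun X Z hX hZ ↦ ?_
        have hfY : MDiffAt (T% (f • Y)) x := hf.smul_section hY
        rw [inner_leviCivitaFun I hX hfY hZ, add_apply, inner_add_left,
          smul_apply, inner_smul_left, inner_leviCivitaFun I hX hY hZ]
        simp [koszul, inner_smul_left, inner_smul_right,
          mvfderiv_fun_mul hf (mdiffAt_metric I hY hZ),
          mvfderiv_fun_mul hf (mdiffAt_metric I hX hY),
          mlieBracket_smul_left hf hY, mlieBracket_smul_right hf hY, inner_add_right]
        rw [real_inner_comm (Y x) (Z x)]
        ring }

theorem leviCivita_torsion : (leviCivita I (M := M)).torsion = 0 := by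
  rw [CovariantDerivative.torsion_eq_zero_iff]
  intro X Y x hX hY
  refine ext_inner_right ℝ fun w ↦ ?_
  have hZ : MDiffAt (T% (FiberBundle.extend E w)) x := FiberBundle.mdifferentiableAt_extend ..
  have h1 := inner_leviCivitaFun I hX hY hZ
  have h2 := inner_leviCivitaFun I hY hX hZ
  simp only [FiberBundle.extend_apply_self] at h1 h2
  change inner ℝ (leviCivitaFun I Y x (X x) - leviCivitaFun I X x (Y x)) w = _
  rw [inner_sub_left, h1, h2]
  simp only [koszul, FiberBundle.extend_apply_self, mlieBracket_swap_apply (V := Y) (W := X),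
    inner_neg_right]
  simp only [real_inner_comm w, fun y ↦ real_inner_comm (X y) (Y y),
    fun y ↦ real_inner_comm (X y) (FiberBundle.extend E w y),
    fun y ↦ real_inner_comm (Y y) (FiberBundle.extend E w y)]
  ring

theorem leviCivita_metric {X Y Z : Π x : M, TangentSpace I x} {x : M}
    (hX : MDiffAt (T% X) x) (hY : MDiffAt (T% Y) x) (hZ : MDiffAt (T% Z) x) :
    d% (fun y ↦ inner ℝ (Y y) (Z y)) x (X x) =
      inner ℝ (leviCivita I Y x (X x)) (Z x) + inner ℝ (Y x) (leviCivita I Z x (X x)) := by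
  have h1 := inner_leviCivitaFun I hX hY hZ
  have h2 := inner_leviCivitaFun I hX hZ hY
  change _ = inner ℝ (leviCivitaFun I Y x (X x)) (Z x) + inner ℝ (Y x) (leviCivitaFun I Z x (X x))
  rw [real_inner_comm _ (Y x), h1, h2]
  simp only [koszul, mlieBracket_swap_apply (V := Z) (W := Y), inner_neg_right,
    fun y ↦ real_inner_comm (Y y) (Z y), fun y ↦ real_inner_comm (X y) (Z y),
    fun y ↦ real_inner_comm (X y) (Y y)]
  ring

/-- The vector field `∇_X Y`. -/
def nabla (X Y : Π x : M, TangentSpace I x) : Π x : M, TangentSpace I x :=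
  fun x ↦ leviCivita I Y x (X x)

/-- The Riemannian curvature `R(X, Y)Z = ∇_X ∇_Y Z - ∇_Y ∇_X Z - ∇_{[X, Y]} Z`. -/
def curvature (X Y Z : Π x : M, TangentSpace I x) : Π x : M, TangentSpace I x :=
  nabla I X (nabla I Y Z) - nabla I Y (nabla I X Z) - nabla I (mlieBracket I X Y) Z

/-- The covariant derivative of the curvature, `(∇_W R)(X, Y)Z`. -/
def nablaCurvature (W X Y Z : Π x : M, TangentSpace I x) : Π x : M, TangentSpace I x :=
  nabla I W (curvature I X Y Z) - curvature I (nabla I W X) Y Z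
    - curvature I X (nabla I W Y) Z - curvature I X Y (nabla I W Z)

end LeviCivita

noncomputable section Contact

/-- Smooth vector fields. -/
def IsSmoothField {M : Type*} [TopologicalSpace M] [ChartedSpace (EuclideanSpace ℝ (Fin 3)) M]
    [IsManifold (𝓡 3) ∞ M] (X : Π x : M, TangentSpace (𝓡 3) x) : Prop :=
  ContMDiff (𝓡 3) ((𝓡 3).prod 𝓘(ℝ, EuclideanSpace ℝ (Fin 3))) ∞
    (fun x ↦ TotalSpace.mk' (EuclideanSpace ℝ (Fin 3)) (E := fun x : M ↦ TangentSpace (𝓡 3) x)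
      x (X x))

/-- Smooth 1-forms. -/
def IsSmoothOneForm {M : Type*} [TopologicalSpace M] [ChartedSpace (EuclideanSpace ℝ (Fin 3)) M]
    [IsManifold (𝓡 3) ∞ M] (A : Π x : M, TangentSpace (𝓡 3) x →L[ℝ] ℝ) : Prop :=
  ContMDiff (𝓡 3) ((𝓡 3).prod 𝓘(ℝ, EuclideanSpace ℝ (Fin 3) →L[ℝ] ℝ)) ∞
    (fun x ↦ TotalSpace.mk' (EuclideanSpace ℝ (Fin 3) →L[ℝ] ℝ)
      (E := fun x : M ↦ TangentSpace (𝓡 3) x →L[ℝ] Trivial M ℝ x) x (A x))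

/-- Smooth tensor fields of type (1, 1). -/
def IsSmoothEndo {M : Type*} [TopologicalSpace M] [ChartedSpace (EuclideanSpace ℝ (Fin 3)) M]
    [IsManifold (𝓡 3) ∞ M] (T : Π x : M, TangentSpace (𝓡 3) x →L[ℝ] TangentSpace (𝓡 3) x) :
    Prop :=
  ContMDiff (𝓡 3)
    ((𝓡 3).prod 𝓘(ℝ, EuclideanSpace ℝ (Fin 3) →L[ℝ] EuclideanSpace ℝ (Fin 3))) ∞
    (fun x ↦ TotalSpace.mk' (EuclideanSpace ℝ (Fin 3) →L[ℝ] EuclideanSpace ℝ (Fin 3))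
      (E := fun x : M ↦ TangentSpace (𝓡 3) x →L[ℝ] TangentSpace (𝓡 3) x) x (T x))

/-- The exterior derivative of a 1-form evaluated on vector fields, with the normalization usual in
contact metric geometry: `2 dη(X, Y) = X(η(Y)) - Y(η(X)) - η([X, Y])`. -/
def dForm {M : Type*} [TopologicalSpace M] [ChartedSpace (EuclideanSpace ℝ (Fin 3)) M]
    [IsManifold (𝓡 3) ∞ M] (η : Π x : M, TangentSpace (𝓡 3) x →L[ℝ] ℝ)
    (X Y : Π x : M, TangentSpace (𝓡 3) x) (x : M) : ℝ :=
  (1 / 2) * (mvfderiv (𝓡 3) (fun y ↦ η y (Y y)) x (X x) - mvfderiv (𝓡 3) (fun y ↦ η y (X y)) x (Y x)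
    - η x (mlieBracket (𝓡 3) X Y x))

/-- A contact metric structure `(η, ξ, φ, g)` on a 3-dimensional manifold with Riemannian
metric `g`. -/
structure ContactMetricStructure (M : Type*) [TopologicalSpace M]
    [ChartedSpace (EuclideanSpace ℝ (Fin 3)) M] [IsManifold (𝓡 3) ∞ M]
    [RiemannianBundle (fun x : M ↦ TangentSpace (𝓡 3) x)] where
  η : Π x : M, TangentSpace (𝓡 3) x →L[ℝ] ℝ
  ξ : Π x : M, TangentSpace (𝓡 3) x
  φ : Π x : M, TangentSpace (𝓡 3) x →L[ℝ] TangentSpace (𝓡 3) x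
  smooth_η : IsSmoothOneForm η
  smooth_ξ : IsSmoothField ξ
  smooth_φ : IsSmoothEndo φ
  /-- `η ∧ dη` vanishes nowhere. -/
  contact : ∀ x : M, ∃ X Y Z : Π x : M, TangentSpace (𝓡 3) x,
    IsSmoothField X ∧ IsSmoothField Y ∧ IsSmoothField Z ∧
      η x (X x) * dForm η Y Z x + η x (Y x) * dForm η Z X x + η x (Z x) * dForm η X Y x ≠ 0
  η_ξ : ∀ x : M, η x (ξ x) = 1
  dη_ξ : ∀ X : Π x : M, TangentSpace (𝓡 3) x, IsSmoothField X → ∀ x, dForm η ξ X x = 0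
  η_eq : ∀ (x : M) (v : TangentSpace (𝓡 3) x), η x v = inner ℝ v (ξ x)
  dη_eq : ∀ X Y : Π x : M, TangentSpace (𝓡 3) x, IsSmoothField X → IsSmoothField Y →
    ∀ x, dForm η X Y x = inner ℝ (X x) (φ x (Y x))
  φ_sq : ∀ (x : M) (v : TangentSpace (𝓡 3) x), φ x (φ x v) = -v + η x v • ξ x

variable (M : Type*) [TopologicalSpace M] [ChartedSpace (EuclideanSpace ℝ (Fin 3)) M]
  [IsManifold (𝓡 3) ∞ M] [RiemannianBundle (fun x : M ↦ TangentSpace (𝓡 3) x)]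
  [IsContMDiffRiemannianBundle (𝓡 3) ∞ (EuclideanSpace ℝ (Fin 3))
    (fun x : M ↦ TangentSpace (𝓡 3) x)]

/-- A Riemannian manifold is flat if its curvature vanishes. -/
def IsFlat : Prop :=
  ∀ X Y Z : Π x : M, TangentSpace (𝓡 3) x, IsSmoothField X → IsSmoothField Y → IsSmoothField Z →
    ∀ x, curvature (𝓡 3) X Y Z x = 0

variable {M}

/-- The fibre at `p` of the `k`-nullity distribution: the tangent vectors `v` at `p` such that
`R(X, Y)v = k (g(Y, v) X - g(X, v) Y)` for all `X`, `Y`. -/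
def nullity (k : ℝ) (p : M) : Set (TangentSpace (𝓡 3) p) :=
  {v | ∀ X Y Z : Π x : M, TangentSpace (𝓡 3) x,
    IsSmoothField X → IsSmoothField Y → IsSmoothField Z → Z p = v →
    curvature (𝓡 3) X Y Z p = k • (inner ℝ (Y p) v • X p - inner ℝ (X p) v • Y p)}

namespace ContactMetricStructure

/-- The structure is an `N(k)`-contact metric structure. -/
def IsNullity (S : ContactMetricStructure M) (k : ℝ) : Prop :=
  ∀ p : M, S.ξ p ∈ nullity k p

/-- The structure is `φ`-recurrent: `φ²((∇_W R)(X, Y)Z) = A(W) R(X, Y)Z` for some 1-form `A` that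
is not identically zero. -/
def IsPhiRecurrent (S : ContactMetricStructure M) : Prop :=
  ∃ A : Π x : M, TangentSpace (𝓡 3) x →L[ℝ] ℝ, IsSmoothOneForm A ∧ (∃ x, A x ≠ 0) ∧
    ∀ W X Y Z : Π x : M, TangentSpace (𝓡 3) x,
      IsSmoothField W → IsSmoothField X → IsSmoothField Y → IsSmoothField Z →
      ∀ x, S.φ x (S.φ x (nablaCurvature (𝓡 3) W X Y Z x)) =
        A x (W x) • curvature (𝓡 3) X Y Z x

end ContactMetricStructure

end Contact

section SmoothFields

theorem minSmoothness_natCast_le_infty (n : ℕ) : minSmoothness ℝ n ≤ ∞ := by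
  rw [minSmoothness_of_isRCLikeNormedField]
  exact_mod_cast le_top

variable {M : Type*} [TopologicalSpace M] [ChartedSpace (EuclideanSpace ℝ (Fin 3)) M]

/-- Smooth real-valued functions on a 3-manifold. -/
def IsSmoothFun (f : M → ℝ) : Prop := ContMDiff (𝓡 3) 𝓘(ℝ) ∞ f

theorem IsSmoothFun.mdiffAt {f : M → ℝ} (hf : IsSmoothFun f) (x : M) :
    MDifferentiableAt (𝓡 3) 𝓘(ℝ) f x :=
  (hf x).mdifferentiableAt (by simp)

variable [IsManifold (𝓡 3) ∞ M]

theorem isManifold_minSmoothness (n : ℕ) : IsManifold (𝓡 3) (minSmoothness ℝ n) M :=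
  IsManifold.of_le (n := ∞) (minSmoothness_natCast_le_infty n)

theorem IsSmoothField.mdiffAt {X : Π x : M, TangentSpace (𝓡 3) x} (hX : IsSmoothField X) (x : M) :
    MDifferentiableAt (𝓡 3) ((𝓡 3).prod 𝓘(ℝ, EuclideanSpace ℝ (Fin 3)))
      (fun x ↦ TotalSpace.mk' (EuclideanSpace ℝ (Fin 3)) (E := fun x : M ↦ TangentSpace (𝓡 3) x)
        x (X x)) x :=
  (hX x).mdifferentiableAt (by simp)

theorem IsSmoothField.add {X Y : Π x : M, TangentSpace (𝓡 3) x} (hX : IsSmoothField X)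
    (hY : IsSmoothField Y) : IsSmoothField (X + Y) :=
  ContMDiff.add_section hX hY

theorem IsSmoothField.sub {X Y : Π x : M, TangentSpace (𝓡 3) x} (hX : IsSmoothField X)
    (hY : IsSmoothField Y) : IsSmoothField (X - Y) :=
  ContMDiff.sub_section hX hY

theorem IsSmoothField.smul {f : M → ℝ} {X : Π x : M, TangentSpace (𝓡 3) x} (hf : IsSmoothFun f)
    (hX : IsSmoothField X) : IsSmoothField (f • X) :=
  ContMDiff.smul_section hf hX

theorem IsSmoothField.mlieBracket {X Y : Π x : M, TangentSpace (𝓡 3) x} (hX : IsSmoothField X)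
    (hY : IsSmoothField Y) : IsSmoothField (mlieBracket (𝓡 3) X Y) := by
  have : IsManifold (𝓡 3) (minSmoothness ℝ 2) M := isManifold_minSmoothness 2
  have : IsManifold (𝓡 3) ((⊤ : ℕ∞) + 1) M := inferInstanceAs (IsManifold (𝓡 3) ∞ M)
  exact ContDiff.mlieBracket_vectorField (m := ⊤) (n := ⊤) hX hY (by simp)

theorem IsSmoothEndo.apply {T : Π x : M, TangentSpace (𝓡 3) x →L[ℝ] TangentSpace (𝓡 3) x}
    {X : Π x : M, TangentSpace (𝓡 3) x} (hT : IsSmoothEndo T) (hX : IsSmoothField X) :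
    IsSmoothField (fun x ↦ T x (X x)) :=
  ContMDiff.clm_bundle_apply (b := fun x ↦ x) hT hX

theorem exists_isSmoothField_eq [T2Space M] (p : M) (v : TangentSpace (𝓡 3) p) :
    ∃ X : Π x : M, TangentSpace (𝓡 3) x, IsSmoothField X ∧ X p = v := by
  let e := trivializationAt (EuclideanSpace ℝ (Fin 3)) (fun x : M ↦ TangentSpace (𝓡 3) x) p
  obtain ⟨ψ⟩ : Nonempty (SmoothBumpFunction (𝓡 3) p) := inferInstance
  refine ⟨(ψ : M → ℝ) • FiberBundle.extend (EuclideanSpace ℝ (Fin 3)) v, ?_, by simp⟩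
  refine ContMDiffOn.smul_section_of_tsupport (u := e.baseSet) ψ.contMDiff.contMDiffOn
    e.open_baseSet ψ.tsupport_subset_chartAt_source ?_
  rw [e.contMDiffOn_section_baseSet_iff]
  refine (contMDiffOn_const (c := (e ⟨p, v⟩).2)).congr fun y hy ↦ ?_
  simp [FiberBundle.extend, e, e.apply_mk_symm hy]

/-- Directional derivatives commute up to the Lie bracket. The identity is read off from the Jacobi
identity for `X`, `Y` and `f • Z`, so it needs a field `Z` that does not vanish at the point and a
priori smoothness of the derivatives of `f`. -/
theorem mvfderiv_mlieBracket {X Y Z : Π x : M, TangentSpace (𝓡 3) x} {f : M → ℝ}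
    (hX : IsSmoothField X) (hY : IsSmoothField Y) (hZ : IsSmoothField Z) (hf : IsSmoothFun f)
    (hXf : IsSmoothFun (fun y ↦ mvfderiv (𝓡 3) f y (X y)))
    (hYf : IsSmoothFun (fun y ↦ mvfderiv (𝓡 3) f y (Y y))) {x : M} (hx : Z x ≠ 0) :
    mvfderiv (𝓡 3) f x (mlieBracket (𝓡 3) X Y x) =
      mvfderiv (𝓡 3) (fun y ↦ mvfderiv (𝓡 3) f y (Y y)) x (X x)
        - mvfderiv (𝓡 3) (fun y ↦ mvfderiv (𝓡 3) f y (X y)) x (Y x) := by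
  have smooth_le : minSmoothness ℝ 2 ≤ ∞ := minSmoothness_natCast_le_infty 2
  have : IsManifold (𝓡 3) (minSmoothness ℝ 2) M := isManifold_minSmoothness 2
  have : IsManifold (𝓡 3) (minSmoothness ℝ 3) M := isManifold_minSmoothness 3
  have bracket : ∀ V : Π x : M, TangentSpace (𝓡 3) x,
      mlieBracket (𝓡 3) V (f • Z) =
        (fun y ↦ mvfderiv (𝓡 3) f y (V y)) • Z + f • mlieBracket (𝓡 3) V Z := by
    intro V
    ext1 y
    exact mlieBracket_smul_right (hf.mdiffAt y) (hZ.mdiffAt y)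
  have jac := fun (V : Π x : M, TangentSpace (𝓡 3) x) (hV : IsSmoothField V) ↦
    leibniz_identity_mlieBracket_apply (I := 𝓡 3) (x := x)
    ((hX x).of_le smooth_le) ((hY x).of_le smooth_le) ((hV x).of_le smooth_le)
  have j1 := jac _ (hZ.smul hf)
  have j2 := jac _ hZ
  rw [bracket X, bracket Y, bracket,
    mlieBracket_add_right ((hZ.smul hYf).mdiffAt x) (((hY.mlieBracket hZ).smul hf).mdiffAt x),
    mlieBracket_add_right ((hZ.smul hXf).mdiffAt x) (((hX.mlieBracket hZ).smul hf).mdiffAt x),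
    mlieBracket_smul_right (hYf.mdiffAt x) (hZ.mdiffAt x),
    mlieBracket_smul_right (hXf.mdiffAt x) (hZ.mdiffAt x),
    mlieBracket_smul_right (hf.mdiffAt x) ((hX.mlieBracket hZ).mdiffAt x),
    mlieBracket_smul_right (hf.mdiffAt x) ((hY.mlieBracket hZ).mdiffAt x), j2] at j1
  simp only [Pi.add_apply, Pi.smul_apply'] at j1
  have key : (mvfderiv (𝓡 3) f x (mlieBracket (𝓡 3) X Y x) -
      (mvfderiv (𝓡 3) (fun y ↦ mvfderiv (𝓡 3) f y (Y y)) x (X x)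
        - mvfderiv (𝓡 3) (fun y ↦ mvfderiv (𝓡 3) f y (X y)) x (Y x))) • Z x = 0 := by
    rw [← sub_eq_zero.2 j1.symm]
    module
  exact sub_eq_zero.1 ((smul_eq_zero.1 key).resolve_right hx)

end SmoothFields

section Inner

variable {M : Type*} [TopologicalSpace M] [ChartedSpace (EuclideanSpace ℝ (Fin 3)) M]
  [IsManifold (𝓡 3) ∞ M] [RiemannianBundle (fun x : M ↦ TangentSpace (𝓡 3) x)]
  [IsContMDiffRiemannianBundle (𝓡 3) ∞ (EuclideanSpace ℝ (Fin 3))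
    (fun x : M ↦ TangentSpace (𝓡 3) x)]

theorem IsSmoothField.inner {X Y : Π x : M, TangentSpace (𝓡 3) x} (hX : IsSmoothField X)
    (hY : IsSmoothField Y) : IsSmoothFun (fun x ↦ inner ℝ (X x) (Y x)) :=
  ContMDiff.inner_bundle (F := EuclideanSpace ℝ (Fin 3)) (E := fun x : M ↦ TangentSpace (𝓡 3) x)
    hX hY

theorem nabla_zero (X : Π x : M, TangentSpace (𝓡 3) x) : nabla (𝓡 3) X 0 = 0 := by
  ext1 x
  simp [nabla]

theorem nabla_const_smul {Y : Π x : M, TangentSpace (𝓡 3) x} (c : ℝ) (hY : IsSmoothField Y)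
    (X : Π x : M, TangentSpace (𝓡 3) x) (x : M) :
    nabla (𝓡 3) X (c • Y) x = c • nabla (𝓡 3) X Y x := by
  have := ((leviCivita (𝓡 3) (M := M)).isCovariantDerivativeOn (s := Set.univ)).smul_const c
    (hY.mdiffAt x)
  exact congrArg (fun L ↦ L (X x)) this

theorem nabla_sub_nabla {X Y : Π x : M, TangentSpace (𝓡 3) x} (hX : IsSmoothField X)
    (hY : IsSmoothField Y) (x : M) :
    nabla (𝓡 3) X Y x - nabla (𝓡 3) Y X x = mlieBracket (𝓡 3) X Y x :=
  (CovariantDerivative.torsion_eq_zero_iff _).1 (leviCivita_torsion (𝓡 3) (M := M))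
    (hX.mdiffAt x) (hY.mdiffAt x)

theorem mvfderiv_inner {X Y Z : Π x : M, TangentSpace (𝓡 3) x} (hX : IsSmoothField X)
    (hY : IsSmoothField Y) (hZ : IsSmoothField Z) (x : M) :
    mvfderiv (𝓡 3) (fun y ↦ inner ℝ (Y y) (Z y)) x (X x) =
      inner ℝ (nabla (𝓡 3) X Y x) (Z x) + inner ℝ (Y x) (nabla (𝓡 3) X Z x) :=
  leviCivita_metric (𝓡 3) (hX.mdiffAt x) (hY.mdiffAt x) (hZ.mdiffAt x)

theorem inner_nabla {X Y Z : Π x : M, TangentSpace (𝓡 3) x} (hX : IsSmoothField X)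
    (hY : IsSmoothField Y) (hZ : IsSmoothField Z) (x : M) :
    inner ℝ (nabla (𝓡 3) X Y x) (Z x) = koszul (𝓡 3) X Y Z x :=
  inner_leviCivitaFun (𝓡 3) (hX.mdiffAt x) (hY.mdiffAt x) (hZ.mdiffAt x)

end Inner

theorem eq_zero_of_inner_orthogonal_frame {V : Type*} [NormedAddCommGroup V] [InnerProductSpace ℝ V]
    (hV : Module.finrank ℝ V = 3) {a b c v : V} (ha : a ≠ 0) (hb : b ≠ 0) (hc : c ≠ 0)
    (hab : inner ℝ b a = 0) (hac : inner ℝ c a = 0) (hbc : inner ℝ c b = 0)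
    (hva : inner ℝ v a = 0) (hvb : inner ℝ v b = 0) (hvc : inner ℝ v c = 0) : v = 0 := by
  by_contra hv
  have : FiniteDimensional ℝ V := Module.finite_of_finrank_eq_succ hV
  have li : LinearIndependent ℝ ![a, b, c, v] := by
    refine linearIndependent_of_ne_zero_of_inner_eq_zero (fun i ↦ ?_) fun i j hij ↦ ?_
    · fin_cases i <;> simpa
    · fin_cases i <;> fin_cases j <;> first | exact absurd rfl hij | simpa | (rw [real_inner_comm]; simpa)
  simpa [hV] using li.fintype_card_le_finrank

namespace ContactMetricStructure

variable {M : Type*} [TopologicalSpace M] [ChartedSpace (EuclideanSpace ℝ (Fin 3)) M]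
  [IsManifold (𝓡 3) ∞ M] [RiemannianBundle (fun x : M ↦ TangentSpace (𝓡 3) x)]

section Pointwise

variable (S : ContactMetricStructure M) (x : M)

theorem inner_ξ_ξ : inner ℝ (S.ξ x) (S.ξ x) = 1 := by rw [← S.η_eq, S.η_ξ]

theorem ξ_ne_zero : S.ξ x ≠ 0 := fun h ↦ by simpa [h] using S.inner_ξ_ξ x

theorem φ_φ (v : TangentSpace (𝓡 3) x) :
    S.φ x (S.φ x v) = -v + inner ℝ v (S.ξ x) • S.ξ x := by rw [S.φ_sq, S.η_eq]

theorem inner_φ_φ_ξ (v : TangentSpace (𝓡 3) x) : inner ℝ (S.φ x (S.φ x v)) (S.ξ x) = 0 := by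
  rw [φ_φ, inner_add_left, inner_neg_left, real_inner_smul_left, inner_ξ_ξ]
  ring

theorem φ_φ_of_horizontal {x : M} {v : TangentSpace (𝓡 3) x} (hv : inner ℝ v (S.ξ x) = 0) :
    S.φ x (S.φ x v) = -v := by simp [φ_φ, hv]

theorem smooth_φ_apply {X : Π x : M, TangentSpace (𝓡 3) x} (hX : IsSmoothField X) :
    IsSmoothField (fun x ↦ S.φ x (X x)) := S.smooth_φ.apply hX

theorem exists_unit_horizontal (p : M) :
    ∃ v : TangentSpace (𝓡 3) p, inner ℝ v (S.ξ p) = 0 ∧ inner ℝ v v = (1 : ℝ) := by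
  have := finiteDimensional_tangentSpace (𝓡 3) p
  have hdim : Module.finrank ℝ (TangentSpace (𝓡 3) p) = 3 := finrank_euclideanSpace_fin (𝕜 := ℝ)
  obtain ⟨w, hw, hw0⟩ : ∃ w ∈ (Submodule.span ℝ {S.ξ p})ᗮ, w ≠ 0 := by
    refine Submodule.exists_mem_ne_zero_of_ne_bot fun h ↦ ?_
    have h1 := Submodule.finrank_add_finrank_orthogonal (Submodule.span ℝ {S.ξ p})
    rw [h, finrank_bot, hdim, finrank_span_singleton (S.ξ_ne_zero p)] at h1
    omega
  have hwξ : inner ℝ w (S.ξ p) = 0 := Submodule.mem_orthogonal_singleton_iff_inner_left.1 hw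
  refine ⟨‖w‖⁻¹ • w, by simp [inner_smul_left, hwξ], ?_⟩
  have : ‖w‖ ≠ 0 := norm_ne_zero_iff.2 hw0
  rw [real_inner_smul_left, real_inner_smul_right, real_inner_self_eq_norm_sq]
  field_simp

variable [T2Space M]

theorem inner_φ_right (v w : TangentSpace (𝓡 3) x) :
    inner ℝ v (S.φ x w) = -inner ℝ (S.φ x v) w := by
  obtain ⟨X, hX, rfl⟩ := exists_isSmoothField_eq x v
  obtain ⟨Y, hY, rfl⟩ := exists_isSmoothField_eq x w
  rw [real_inner_comm _ (S.φ x (X x)), ← S.dη_eq X Y hX hY, ← S.dη_eq Y X hY hX, dForm, dForm,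
    mlieBracket_swap_apply (V := Y), map_neg]
  ring

theorem inner_φ_self (v : TangentSpace (𝓡 3) x) : inner ℝ v (S.φ x v) = 0 := by
  have := S.inner_φ_right x v v
  rw [real_inner_comm v (S.φ x v)] at this
  linarith

theorem φ_ξ : S.φ x (S.ξ x) = 0 := by
  have h : S.φ x (S.φ x (S.ξ x)) = 0 := by
    rw [φ_φ, inner_ξ_ξ, one_smul, neg_add_cancel]
  have := S.inner_φ_right x (S.φ x (S.ξ x)) (S.ξ x)
  rw [h, inner_zero_left, neg_zero] at this
  exact inner_self_eq_zero.1 this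

theorem inner_φ_ξ (v : TangentSpace (𝓡 3) x) : inner ℝ (S.φ x v) (S.ξ x) = 0 := by
  have := S.inner_φ_right x v (S.ξ x)
  rw [S.φ_ξ, inner_zero_right] at this
  linarith

variable {x}

theorem inner_φ_φ_of_horizontal {v : TangentSpace (𝓡 3) x} (hv : inner ℝ v (S.ξ x) = 0) :
    inner ℝ (S.φ x v) (S.φ x v) = inner ℝ v v := by
  rw [S.inner_φ_right, S.φ_φ_of_horizontal hv, inner_neg_left, neg_neg]

theorem eq_zero_of_inner_frame {u v : TangentSpace (𝓡 3) x} (hu : u ≠ 0)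
    (huξ : inner ℝ u (S.ξ x) = 0) (h₁ : inner ℝ v (S.ξ x) = 0) (h₂ : inner ℝ v u = 0)
    (h₃ : inner ℝ v (S.φ x u) = 0) : v = 0 := by
  have hφu : S.φ x u ≠ 0 := fun h ↦ by
    have := S.inner_φ_φ_of_horizontal huξ
    rw [h, inner_zero_left] at this
    exact hu (inner_self_eq_zero.1 this.symm)
  have hdim : Module.finrank ℝ (TangentSpace (𝓡 3) x) = 3 := finrank_euclideanSpace_fin (𝕜 := ℝ)
  refine eq_zero_of_inner_orthogonal_frame hdim (S.ξ_ne_zero x) hu hφu huξ (S.inner_φ_ξ x u) ?_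
    h₁ h₂ h₃
  rw [real_inner_comm, S.inner_φ_self]

/-- Expansion of a tangent vector in the orthogonal frame `ξ, u, φ u`. -/
theorem inner_self_smul_eq {u : TangentSpace (𝓡 3) x} (huξ : inner ℝ u (S.ξ x) = 0)
    (v : TangentSpace (𝓡 3) x) :
    inner ℝ u u • v = (inner ℝ u u * inner ℝ v (S.ξ x)) • S.ξ x + inner ℝ v u • u
      + inner ℝ v (S.φ x u) • S.φ x u := by
  by_cases hu : u = 0
  · simp [hu]
  have hu' : inner ℝ (S.φ x u) u = 0 := by rw [real_inner_comm, S.inner_φ_self]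
  rw [← sub_eq_zero]
  refine S.eq_zero_of_inner_frame hu huξ ?_ ?_ ?_ <;>
    simp only [inner_sub_left, inner_add_left, real_inner_smul_left, huξ, inner_ξ_ξ, inner_φ_ξ,
      inner_φ_self, S.inner_φ_φ_of_horizontal huξ, hu', real_inner_comm u (S.ξ x),
      real_inner_comm (S.φ x u) (S.ξ x)] <;>
    ring

theorem eq_of_inner_self_eq_one {u : TangentSpace (𝓡 3) x} (huξ : inner ℝ u (S.ξ x) = 0)
    (hu : inner ℝ u u = (1 : ℝ)) {v : TangentSpace (𝓡 3) x} (hv : inner ℝ v (S.ξ x) = 0) :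
    v = inner ℝ v u • u + inner ℝ v (S.φ x u) • S.φ x u := by
  have h := S.inner_self_smul_eq huξ v
  rwa [hu, hv, one_smul, mul_zero, zero_smul, zero_add] at h

theorem inner_self_mul_inner_eq {u : TangentSpace (𝓡 3) x} (huξ : inner ℝ u (S.ξ x) = 0)
    (v w : TangentSpace (𝓡 3) x) :
    inner ℝ u u * inner ℝ v w = inner ℝ u u * inner ℝ v (S.ξ x) * inner ℝ w (S.ξ x)
      + inner ℝ v u * inner ℝ w u + inner ℝ v (S.φ x u) * inner ℝ w (S.φ x u) := by
  have := congrArg (fun a ↦ inner ℝ a w) (S.inner_self_smul_eq huξ v)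
  simp only [inner_add_left, real_inner_smul_left] at this
  rw [this, real_inner_comm w, real_inner_comm w, real_inner_comm w]

end Pointwise

variable [IsContMDiffRiemannianBundle (𝓡 3) ∞ (EuclideanSpace ℝ (Fin 3))
    (fun x : M ↦ TangentSpace (𝓡 3) x)]

theorem smooth_mvfderiv (S : ContactMetricStructure M)
    {f : M → ℝ} {X : Π x : M, TangentSpace (𝓡 3) x} (hf : IsSmoothFun f)
    (hX : IsSmoothField X) : IsSmoothFun (fun y ↦ mvfderiv (𝓡 3) f y (X y)) := by
  have : IsManifold (𝓡 3) (minSmoothness ℝ 2) M := isManifold_minSmoothness 2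
  have h : (fun y ↦ mvfderiv (𝓡 3) f y (X y)) = fun y ↦
      inner ℝ (mlieBracket (𝓡 3) X (f • S.ξ) y) (S.ξ y)
        - f y * inner ℝ (mlieBracket (𝓡 3) X S.ξ y) (S.ξ y) := by
    ext1 y
    rw [mlieBracket_smul_right (hf.mdiffAt y) (S.smooth_ξ.mdiffAt y)]
    rw [inner_add_left, real_inner_smul_left, real_inner_smul_left, inner_ξ_ξ]
    ring
  rw [h]
  exact ContMDiff.sub ((hX.mlieBracket (S.smooth_ξ.smul hf)).inner S.smooth_ξ)
    (ContMDiff.mul hf ((hX.mlieBracket S.smooth_ξ).inner S.smooth_ξ))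

theorem smooth_koszul (S : ContactMetricStructure M)
    {X Y Z : Π x : M, TangentSpace (𝓡 3) x} (hX : IsSmoothField X)
    (hY : IsSmoothField Y) (hZ : IsSmoothField Z) : IsSmoothFun (koszul (𝓡 3) X Y Z) := by
  refine ContMDiff.mul contMDiff_const (ContMDiff.add (ContMDiff.sub (ContMDiff.sub
    (ContMDiff.sub (ContMDiff.add ?_ ?_) ?_) ?_) ?_) ?_)
  · exact S.smooth_mvfderiv (hY.inner hZ) hX
  · exact S.smooth_mvfderiv (hZ.inner hX) hY
  · exact S.smooth_mvfderiv (hX.inner hY) hZ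
  · exact hX.inner (hY.mlieBracket hZ)
  · exact hY.inner (hX.mlieBracket hZ)
  · exact hZ.inner (hX.mlieBracket hY)

variable [T2Space M]

theorem exists_horizontal_eq (S : ContactMetricStructure M) {p : M} {v : TangentSpace (𝓡 3) p}
    (hv : inner ℝ v (S.ξ p) = 0) :
    ∃ V : Π x : M, TangentSpace (𝓡 3) x, IsSmoothField V ∧ V p = v ∧
      ∀ x, inner ℝ (V x) (S.ξ x) = 0 := by
  obtain ⟨X, hX, rfl⟩ := exists_isSmoothField_eq p v
  refine ⟨X - (fun x ↦ inner ℝ (X x) (S.ξ x)) • S.ξ,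
    hX.sub (S.smooth_ξ.smul (hX.inner S.smooth_ξ)), by simp [hv], fun x ↦ ?_⟩
  simp only [Pi.sub_apply, Pi.smul_apply', inner_sub_left, real_inner_smul_left, inner_ξ_ξ]
  ring

theorem smooth_nabla (S : ContactMetricStructure M)
    {X Y : Π x : M, TangentSpace (𝓡 3) x} (hX : IsSmoothField X)
    (hY : IsSmoothField Y) : IsSmoothField (nabla (𝓡 3) X Y) := by
  intro p
  obtain ⟨v, hvξ, hv⟩ := S.exists_unit_horizontal p
  obtain ⟨V, hV, rfl, hVξ⟩ := S.exists_horizontal_eq hvξ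
  have hW := S.smooth_φ_apply hV
  have smooth : IsSmoothField (((fun x ↦ inner ℝ (V x) (V x)) * koszul (𝓡 3) X Y S.ξ) • S.ξ
      + koszul (𝓡 3) X Y V • V
      + koszul (𝓡 3) X Y (fun x ↦ S.φ x (V x)) • fun x ↦ S.φ x (V x)) :=
    ((S.smooth_ξ.smul (ContMDiff.mul (hV.inner hV) (S.smooth_koszul hX hY S.smooth_ξ))).add
      (hV.smul (S.smooth_koszul hX hY hV))).add (hW.smul (S.smooth_koszul hX hY hW))
  have hinv : ContMDiffAt (𝓡 3) 𝓘(ℝ) ∞ (fun x ↦ (inner ℝ (V x) (V x) : ℝ)⁻¹) p :=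
    ContMDiffAt.inv₀ (hV.inner hV p) (by rw [hv]; exact one_ne_zero)
  refine (ContMDiffAt.smul_section hinv (smooth p)).congr_of_eventuallyEq ?_
  have hne : ∀ᶠ x in nhds p, (inner ℝ (V x) (V x) : ℝ) ≠ 0 :=
    (hV.inner hV).continuous.continuousAt.eventually_ne (by rw [hv]; exact one_ne_zero)
  filter_upwards [hne] with x hx
  have hk := S.inner_self_smul_eq (hVξ x) (nabla (𝓡 3) X Y x)
  rw [inner_nabla hX hY S.smooth_ξ, inner_nabla hX hY hV, inner_nabla hX hY hW] at hk
  congr 1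
  simp only [Pi.smul_apply', Pi.add_apply, Pi.mul_apply]
  rw [← hk, inv_smul_smul₀ hx]

theorem inner_curvature_left (S : ContactMetricStructure M)
    {X Y Z W : Π x : M, TangentSpace (𝓡 3) x} (hX : IsSmoothField X)
    (hY : IsSmoothField Y) (hZ : IsSmoothField Z) (hW : IsSmoothField W) (x : M) :
    inner ℝ (curvature (𝓡 3) X Y Z x) (W x) = -inner ℝ (curvature (𝓡 3) X Y W x) (Z x) := by
  have first : ∀ {A : Π x : M, TangentSpace (𝓡 3) x}, IsSmoothField A →
      (fun y ↦ mvfderiv (𝓡 3) (fun y ↦ inner ℝ (Z y) (W y)) y (A y)) = fun y ↦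
        inner ℝ (nabla (𝓡 3) A Z y) (W y) + inner ℝ (Z y) (nabla (𝓡 3) A W y) :=
    fun hA ↦ funext (mvfderiv_inner hA hZ hW)
  have second : ∀ {A B : Π x : M, TangentSpace (𝓡 3) x}, IsSmoothField A → IsSmoothField B →
      mvfderiv (𝓡 3) (fun y ↦ mvfderiv (𝓡 3) (fun y ↦ inner ℝ (Z y) (W y)) y (B y)) x (A x) =
        inner ℝ (nabla (𝓡 3) A (nabla (𝓡 3) B Z) x) (W x)
          + inner ℝ (nabla (𝓡 3) B Z x) (nabla (𝓡 3) A W x)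
          + (inner ℝ (nabla (𝓡 3) A Z x) (nabla (𝓡 3) B W x)
          + inner ℝ (Z x) (nabla (𝓡 3) A (nabla (𝓡 3) B W) x)) := by
    intro A B hA hB
    have hBZ := S.smooth_nabla hB hZ
    have hBW := S.smooth_nabla hB hW
    rw [first hB, mvfderiv_fun_add ((hBZ.inner hW).mdiffAt x) ((hZ.inner hBW).mdiffAt x),
      add_apply, mvfderiv_inner hA hBZ hW, mvfderiv_inner hA hZ hBW]
  have h := mvfderiv_mlieBracket hX hY S.smooth_ξ (hZ.inner hW)
    (S.smooth_mvfderiv (hZ.inner hW) hX) (S.smooth_mvfderiv (hZ.inner hW) hY) (S.ξ_ne_zero x)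
  rw [second hX hY, second hY hX, mvfderiv_inner (hX.mlieBracket hY) hZ hW] at h
  simp only [curvature, Pi.sub_apply, inner_sub_left]
  simp only [real_inner_comm (Z x)] at h ⊢
  linarith

end ContactMetricStructure

namespace ContactMetricStructure

variable {M : Type*} [TopologicalSpace M] [ChartedSpace (EuclideanSpace ℝ (Fin 3)) M]
  [IsManifold (𝓡 3) ∞ M] [RiemannianBundle (fun x : M ↦ TangentSpace (𝓡 3) x)]
  [IsContMDiffRiemannianBundle (𝓡 3) ∞ (EuclideanSpace ℝ (Fin 3))
    (fun x : M ↦ TangentSpace (𝓡 3) x)]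
  {S : ContactMetricStructure M}

section NablaReeb

variable (S : ContactMetricStructure M) (x : M)

/-- The endomorphism `v ↦ ∇_v ξ` of the tangent space at `x`. -/
noncomputable def nablaξ : TangentSpace (𝓡 3) x →L[ℝ] TangentSpace (𝓡 3) x :=
  leviCivita (𝓡 3) S.ξ x

theorem nabla_ξ (X : Π x : M, TangentSpace (𝓡 3) x) : nabla (𝓡 3) X S.ξ x = S.nablaξ x (X x) := rfl

theorem inner_nabla_ξ_eq_neg {X Y : Π x : M, TangentSpace (𝓡 3) x} (hX : IsSmoothField X)
    (hY : IsSmoothField Y) (hYξ : ∀ x, inner ℝ (Y x) (S.ξ x) = 0) :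
    inner ℝ (nabla (𝓡 3) X Y x) (S.ξ x) = -inner ℝ (Y x) (S.nablaξ x (X x)) := by
  have h := mvfderiv_inner hX hY S.smooth_ξ x
  simp only [hYξ, mvfderiv_const, zero_apply, nabla_ξ] at h
  linarith

variable [T2Space M]

theorem inner_nablaξ_ξ (v : TangentSpace (𝓡 3) x) : inner ℝ (S.nablaξ x v) (S.ξ x) = 0 := by
  obtain ⟨X, hX, rfl⟩ := exists_isSmoothField_eq x v
  have h := mvfderiv_inner hX S.smooth_ξ S.smooth_ξ x
  simp only [inner_ξ_ξ, mvfderiv_const, zero_apply, nabla_ξ] at h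
  rw [real_inner_comm (S.nablaξ x (X x)) (S.ξ x)] at h
  linarith

theorem inner_nablaξ_sub (v w : TangentSpace (𝓡 3) x) :
    inner ℝ (S.nablaξ x v) w - inner ℝ (S.nablaξ x w) v = 2 * inner ℝ v (S.φ x w) := by
  obtain ⟨X, hX, rfl⟩ := exists_isSmoothField_eq x v
  obtain ⟨Y, hY, rfl⟩ := exists_isSmoothField_eq x w
  rw [← S.dη_eq X Y hX hY, dForm]
  simp only [S.η_eq]
  rw [mvfderiv_inner hX hY S.smooth_ξ, mvfderiv_inner hY hX S.smooth_ξ, ← nabla_sub_nabla hX hY,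
    inner_sub_left, nabla_ξ, nabla_ξ, real_inner_comm _ (Y x), real_inner_comm _ (X x)]
  ring

theorem nablaξ_ξ : S.nablaξ x (S.ξ x) = 0 := by
  refine ext_inner_right ℝ fun w ↦ ?_
  have h := S.inner_nablaξ_sub x (S.ξ x) w
  rw [real_inner_comm, S.inner_φ_right, S.φ_ξ, S.inner_nablaξ_ξ] at h
  rw [real_inner_comm]
  simp at h
  simpa using h

end NablaReeb

theorem IsNullity.curvature_ξ {k : ℝ} (hS : S.IsNullity k) {X Y : Π x : M, TangentSpace (𝓡 3) x}
    (hX : IsSmoothField X) (hY : IsSmoothField Y) (x : M) :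
    curvature (𝓡 3) X Y S.ξ x =
      k • (inner ℝ (Y x) (S.ξ x) • X x - inner ℝ (X x) (S.ξ x) • Y x) :=
  hS x X Y S.ξ hX hY S.smooth_ξ rfl

theorem IsNullity.curvature_ξ_eq_zero (hS : S.IsNullity 0) {X Y : Π x : M, TangentSpace (𝓡 3) x}
    (hX : IsSmoothField X) (hY : IsSmoothField Y) (x : M) : curvature (𝓡 3) X Y S.ξ x = 0 := by
  rw [hS.curvature_ξ hX hY, zero_smul]

/-- The Codazzi equation for `∇ξ`. -/
theorem IsNullity.codazzi (hS : S.IsNullity 0) {X Y : Π x : M, TangentSpace (𝓡 3) x}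
    (hX : IsSmoothField X) (hY : IsSmoothField Y) (x : M) :
    nabla (𝓡 3) X (nabla (𝓡 3) Y S.ξ) x - nabla (𝓡 3) Y (nabla (𝓡 3) X S.ξ) x =
      S.nablaξ x (nabla (𝓡 3) X Y x) - S.nablaξ x (nabla (𝓡 3) Y X x) := by
  have h := hS.curvature_ξ_eq_zero hX hY x
  simp only [curvature, Pi.sub_apply] at h
  rw [nabla_ξ S x (mlieBracket (𝓡 3) X Y), ← nabla_sub_nabla hX hY, map_sub] at h
  exact sub_eq_zero.1 h

theorem isNullity_zero_of_isFlat (hM : IsFlat M) : S.IsNullity 0 := by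
  rintro p X Y Z hX hY hZ -
  rw [hM X Y Z hX hY hZ, zero_smul]

variable [T2Space M]

/-- The Riccati equation for `∇ξ` along the Reeb flow. -/
theorem IsNullity.riccati (hS : S.IsNullity 0) {X : Π x : M, TangentSpace (𝓡 3) x}
    (hX : IsSmoothField X) (x : M) :
    nabla (𝓡 3) S.ξ (nabla (𝓡 3) X S.ξ) x =
      S.nablaξ x (nabla (𝓡 3) S.ξ X x) - S.nablaξ x (S.nablaξ x (X x)) := by
  have h := hS.codazzi S.smooth_ξ hX x
  have h0 : nabla (𝓡 3) S.ξ S.ξ = 0 := funext fun y ↦ S.nablaξ_ξ y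
  rwa [h0, nabla_zero, Pi.zero_apply, sub_zero] at h

theorem IsNullity.mvfderiv_inner_nablaξ (hS : S.IsNullity 0) {X Y : Π x : M, TangentSpace (𝓡 3) x}
    (hX : IsSmoothField X) (hY : IsSmoothField Y) (x : M) :
    mvfderiv (𝓡 3) (fun y ↦ inner ℝ (S.nablaξ y (X y)) (Y y)) x (S.ξ x) =
      inner ℝ (S.nablaξ x (nabla (𝓡 3) S.ξ X x)) (Y x)
        - inner ℝ (S.nablaξ x (S.nablaξ x (X x))) (Y x)
        + inner ℝ (S.nablaξ x (X x)) (nabla (𝓡 3) S.ξ Y x) := by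
  rw [← inner_sub_left, ← hS.riccati hX]
  exact mvfderiv_inner S.smooth_ξ (S.smooth_nabla hX S.smooth_ξ) hY x

/-- The Reeb derivatives of a horizontal field `V` and of `φ V`, in the frame `V, φ V` at a point
where `V` has length 1. -/
theorem nabla_ξ_horizontal_frame {V : Π x : M, TangentSpace (𝓡 3) x} (hV : IsSmoothField V)
    (hVξ : ∀ x, inner ℝ (V x) (S.ξ x) = 0) {x : M} (hVx : inner ℝ (V x) (V x) = (1 : ℝ)) :
    ∃ a c : ℝ, nabla (𝓡 3) S.ξ V x = a • V x + c • S.φ x (V x) ∧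
      nabla (𝓡 3) S.ξ (fun y ↦ S.φ y (V y)) x = (-c) • V x + a • S.φ x (V x) ∧
      mvfderiv (𝓡 3) (fun y ↦ inner ℝ (V y) (V y)) x (S.ξ x) = 2 * a := by
  have hW := S.smooth_φ_apply hV
  have h1 := S.inner_nabla_ξ_eq_neg x S.smooth_ξ hV hVξ
  have h2 := S.inner_nabla_ξ_eq_neg x S.smooth_ξ hW fun y ↦ S.inner_φ_ξ y _
  rw [nablaξ_ξ, inner_zero_right, neg_zero] at h1 h2
  have dVV := mvfderiv_inner S.smooth_ξ hV hV x
  have dWW := mvfderiv_inner S.smooth_ξ hW hW x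
  have dVW := mvfderiv_inner S.smooth_ξ hV hW x
  simp only [fun y ↦ S.inner_φ_φ_of_horizontal (hVξ y)] at dWW
  simp only [inner_φ_self, mvfderiv_const, zero_apply] at dVW
  rw [real_inner_comm _ (V x)] at dVV dVW
  rw [real_inner_comm _ (S.φ x (V x))] at dWW
  refine ⟨inner ℝ (nabla (𝓡 3) S.ξ V x) (V x), inner ℝ (nabla (𝓡 3) S.ξ V x) (S.φ x (V x)),
    S.eq_of_inner_self_eq_one (hVξ x) hVx h1, ?_, by linarith⟩
  rw [S.eq_of_inner_self_eq_one (hVξ x) hVx h2]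
  congr 2 <;> linarith

theorem nablaξ_horizontal_frame {x : M} {v : TangentSpace (𝓡 3) x} (hvξ : inner ℝ v (S.ξ x) = 0)
    (hv : inner ℝ v v = (1 : ℝ)) :
    ∃ p q s : ℝ, S.nablaξ x v = p • v + q • S.φ x v ∧
      S.nablaξ x (S.φ x v) = (q + 2) • v + s • S.φ x v := by
  refine ⟨_, _, inner ℝ (S.nablaξ x (S.φ x v)) (S.φ x v),
    S.eq_of_inner_self_eq_one hvξ hv (S.inner_nablaξ_ξ x v), ?_⟩
  have h := S.inner_nablaξ_sub x v (S.φ x v)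
  rw [S.φ_φ_of_horizontal hvξ, inner_neg_right, hv] at h
  have e := S.eq_of_inner_self_eq_one hvξ hv (S.inner_nablaξ_ξ x (S.φ x v))
  rwa [show inner ℝ (S.nablaξ x (S.φ x v)) v = inner ℝ (S.nablaξ x v) (S.φ x v) + 2 by linarith] at e

theorem IsNullity.trace_nablaξ_of_unit (hS : S.IsNullity 0) {x : M} {v : TangentSpace (𝓡 3) x}
    (hvξ : inner ℝ v (S.ξ x) = 0) (hv : inner ℝ v v = (1 : ℝ)) :
    inner ℝ (S.nablaξ x v) v + inner ℝ (S.nablaξ x (S.φ x v)) (S.φ x v) = 0 := by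
  obtain ⟨V, hV, rfl, hVξ⟩ := S.exists_horizontal_eq hvξ
  have hW := S.smooth_φ_apply hV
  obtain ⟨a, c, h1, h2, h3⟩ := nabla_ξ_horizontal_frame hV hVξ hv
  obtain ⟨p, q, s, h4, h5⟩ := nablaξ_horizontal_frame hvξ hv
  have hww := S.inner_φ_φ_of_horizontal hvξ
  rw [hv] at hww
  have hvw := S.inner_φ_self x (V x)
  have hwv : inner ℝ (S.φ x (V x)) (V x) = (0 : ℝ) := by rw [real_inner_comm, hvw]
  have d1 := hS.mvfderiv_inner_nablaξ hV hW x
  have d2 := hS.mvfderiv_inner_nablaξ hW hV x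
  have fn : (fun y ↦ inner ℝ (S.nablaξ y (V y)) (S.φ y (V y))) = (fun y ↦
      inner ℝ (S.nablaξ y (S.φ y (V y))) (V y) + (-2) * inner ℝ (V y) (V y)) := by
    ext1 y
    have h := S.inner_nablaξ_sub y (V y) (S.φ y (V y))
    rw [S.φ_φ_of_horizontal (hVξ y), inner_neg_right] at h
    linarith
  have hVV := (hV.inner hV).mdiffAt x
  have hTW : IsSmoothField (fun y ↦ S.nablaξ y (S.φ y (V y))) := S.smooth_nabla hW S.smooth_ξ
  have hVV' : MDifferentiableAt (𝓡 3) 𝓘(ℝ) (fun y ↦ (-2 : ℝ) * inner ℝ (V y) (V y)) x :=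
    mdifferentiableAt_const.mul hVV
  rw [fn, mvfderiv_fun_add ((hTW.inner hV).mdiffAt x) hVV',
    mvfderiv_fun_mul mdifferentiableAt_const hVV, add_apply, d2] at d1
  simp only [mvfderiv_const, smul_apply, smul_zero, add_zero, h3, smul_eq_mul] at d1
  simp only [h1, h2, h4, h5, map_add, map_smul, inner_add_left, inner_add_right,
    real_inner_smul_left, real_inner_smul_right, hv, hww, hvw, hwv] at d1 ⊢
  linarith

theorem IsNullity.trace_nablaξ (hS : S.IsNullity 0) {x : M} {v : TangentSpace (𝓡 3) x}
    (hvξ : inner ℝ v (S.ξ x) = 0) :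
    inner ℝ (S.nablaξ x v) v + inner ℝ (S.nablaξ x (S.φ x v)) (S.φ x v) = 0 := by
  by_cases hv : v = 0
  · simp [hv]
  have hn : ‖v‖ ≠ 0 := norm_ne_zero_iff.2 hv
  have h := hS.trace_nablaξ_of_unit (v := ‖v‖⁻¹ • v) (by rw [real_inner_smul_left, hvξ, mul_zero])
    (by
      rw [real_inner_smul_left, real_inner_smul_right, real_inner_self_eq_norm_sq]
      field_simp)
  simp only [map_smul, real_inner_smul_left, real_inner_smul_right] at h
  field_simp at h
  simpa using h

theorem IsNullity.nablaξ_nablaξ_of_unit (hS : S.IsNullity 0) {x : M} {v : TangentSpace (𝓡 3) x}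
    (hvξ : inner ℝ v (S.ξ x) = 0) (hv : inner ℝ v v = (1 : ℝ)) :
    S.nablaξ x (S.nablaξ x v) = 0 ∧ S.nablaξ x (S.nablaξ x (S.φ x v)) = 0 := by
  have tr := hS.trace_nablaξ hvξ
  obtain ⟨V, hV, rfl, hVξ⟩ := S.exists_horizontal_eq hvξ
  have hW := S.smooth_φ_apply hV
  obtain ⟨a, c, h1, h2, h3⟩ := nabla_ξ_horizontal_frame hV hVξ hv
  obtain ⟨p, q, s, h4, h5⟩ := nablaξ_horizontal_frame hvξ hv
  have hww := S.inner_φ_φ_of_horizontal hvξ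
  rw [hv] at hww
  have hvw := S.inner_φ_self x (V x)
  have hwv : inner ℝ (S.φ x (V x)) (V x) = (0 : ℝ) := by rw [real_inner_comm, hvw]
  have d1 := hS.mvfderiv_inner_nablaξ hV hV x
  have d2 := hS.mvfderiv_inner_nablaξ hW hW x
  have hTV : IsSmoothField (fun y ↦ S.nablaξ y (V y)) := S.smooth_nabla hV S.smooth_ξ
  have hTW : IsSmoothField (fun y ↦ S.nablaξ y (S.φ y (V y))) := S.smooth_nabla hW S.smooth_ξ
  have d := mvfderiv_fun_add ((hTV.inner hV).mdiffAt x) ((hTW.inner hW).mdiffAt x)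
  replace d := congrArg (fun L ↦ L (S.ξ x)) d
  simp only [fun y ↦ hS.trace_nablaξ (hVξ y), mvfderiv_const, zero_apply, add_apply, d1, d2] at d
  simp only [h1, h2, h4, h5, map_add, map_smul, inner_add_left, inner_add_right,
    real_inner_smul_left, real_inner_smul_right, hv, hww, hvw, hwv] at d tr
  have hs : s = -p := by linarith
  subst hs
  have hdet : p * p + q * (q + 2) = 0 := by linarith
  constructor
  · rw [h4, map_add, map_smul, map_smul, h4, h5]
    rw [show p • (p • V x + q • S.φ x (V x)) + q • ((q + 2) • V x + -p • S.φ x (V x)) =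
      (p * p + q * (q + 2)) • V x by module, hdet, zero_smul]
  · rw [h5, map_add, map_smul, map_smul, h4, h5]
    rw [show (q + 2) • (p • V x + q • S.φ x (V x)) + -p • ((q + 2) • V x + -p • S.φ x (V x)) =
      (p * p + q * (q + 2)) • S.φ x (V x) by module, hdet, zero_smul]

theorem IsNullity.nablaξ_nablaξ (hS : S.IsNullity 0) (x : M) (w : TangentSpace (𝓡 3) x) :
    S.nablaξ x (S.nablaξ x w) = 0 := by
  obtain ⟨v, hvξ, hv⟩ := S.exists_unit_horizontal x
  obtain ⟨h1, h2⟩ := hS.nablaξ_nablaξ_of_unit hvξ hv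
  have h := S.inner_self_smul_eq hvξ w
  rw [hv, one_smul] at h
  rw [h]
  simp [h1, h2, nablaξ_ξ]

/-- A horizontal vector field annihilated by `∇ξ` that does not vanish at a given point. -/
theorem IsNullity.exists_nablaξ_eq_zero (hS : S.IsNullity 0) (p : M) :
    ∃ U : Π x : M, TangentSpace (𝓡 3) x, IsSmoothField U ∧ U p ≠ 0 ∧
      (∀ x, inner ℝ (U x) (S.ξ x) = 0) ∧ ∀ x, S.nablaξ x (U x) = 0 := by
  obtain ⟨v, hv⟩ : ∃ v, S.nablaξ p v ≠ 0 := by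
    by_contra! h
    obtain ⟨v, hvξ, hv⟩ := S.exists_unit_horizontal p
    have := S.inner_nablaξ_sub p v (S.φ p v)
    rw [h, h, inner_zero_left, inner_zero_left, S.φ_φ_of_horizontal hvξ, inner_neg_right, hv] at this
    norm_num at this
  obtain ⟨V, hV, rfl⟩ := exists_isSmoothField_eq p v
  exact ⟨nabla (𝓡 3) V S.ξ, S.smooth_nabla hV S.smooth_ξ, hv, fun x ↦ S.inner_nablaξ_ξ x _,
    fun x ↦ hS.nablaξ_nablaξ x _⟩

section Adapted

variable {U : Π x : M, TangentSpace (𝓡 3) x}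

theorem IsNullity.nablaξ_φ (hS : S.IsNullity 0) {x : M} {u : TangentSpace (𝓡 3) x}
    (huξ : inner ℝ u (S.ξ x) = 0) (hu : S.nablaξ x u = 0) :
    S.nablaξ x (S.φ x u) = (2 : ℝ) • u := by
  by_cases hu0 : u = 0
  · simp [hu0]
  have h1 := S.inner_nablaξ_sub x u (S.φ x u)
  rw [S.φ_φ_of_horizontal huξ, hu, inner_zero_left, inner_neg_right] at h1
  have h2 := hS.trace_nablaξ huξ
  rw [hu, inner_zero_left, zero_add] at h2
  rw [← sub_eq_zero]
  refine S.eq_zero_of_inner_frame hu0 huξ ?_ ?_ ?_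
  · rw [inner_sub_left, real_inner_smul_left, huξ, S.inner_nablaξ_ξ]
    ring
  · rw [inner_sub_left, real_inner_smul_left]
    linarith
  · rw [inner_sub_left, real_inner_smul_left, h2, S.inner_φ_self]
    ring

theorem IsNullity.inner_self_smul_nablaξ (hS : S.IsNullity 0) {x : M} {u : TangentSpace (𝓡 3) x}
    (huξ : inner ℝ u (S.ξ x) = 0) (hu : S.nablaξ x u = 0) (v : TangentSpace (𝓡 3) x) :
    inner ℝ u u • S.nablaξ x v = (2 * inner ℝ v (S.φ x u)) • u := by
  rw [← map_smul, S.inner_self_smul_eq huξ v, map_add, map_add, map_smul, map_smul, map_smul,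
    hu, S.nablaξ_ξ, hS.nablaξ_φ huξ hu]
  module

theorem IsNullity.inner_nabla_φ (hS : S.IsNullity 0) (hU : IsSmoothField U)
    (hUξ : ∀ x, inner ℝ (U x) (S.ξ x) = 0) (hTU : ∀ x, S.nablaξ x (U x) = 0)
    (X : Π x : M, TangentSpace (𝓡 3) x) (x : M) :
    inner ℝ (nabla (𝓡 3) X U x) (S.φ x (U x)) = 0 := by
  by_cases hx : U x = 0
  · simp [hx]
  have hW := S.smooth_φ_apply hU
  have hUU : (inner ℝ (U x) (U x) : ℝ) ≠ 0 := inner_self_ne_zero.2 hx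
  have fTU : nabla (𝓡 3) U S.ξ = 0 := funext hTU
  have fTW : nabla (𝓡 3) (fun y ↦ S.φ y (U y)) S.ξ = (2 : ℝ) • U :=
    funext fun y ↦ hS.nablaξ_φ (hUξ y) (hTU y)
  have image := hS.inner_self_smul_nablaξ (hUξ x) (hTU x)
  have eξ : inner ℝ (nabla (𝓡 3) S.ξ U x) (S.φ x (U x)) = 0 := by
    have h := hS.riccati hU x
    rw [fTU, nabla_zero, hTU, map_zero, sub_zero, Pi.zero_apply] at h
    have h' := image (nabla (𝓡 3) S.ξ U x)
    rw [← h, smul_zero] at h'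
    have := (smul_eq_zero.1 h'.symm).resolve_right hx
    linarith
  have cod := hS.codazzi hU hW x
  rw [fTU, fTW, nabla_zero, nabla_const_smul _ hU, Pi.zero_apply, sub_zero] at cod
  replace cod := congrArg (fun w ↦ inner ℝ (U x) (U x) • w) cod
  simp only [smul_sub, image] at cod
  have eU : inner ℝ (nabla (𝓡 3) U U x) (S.φ x (U x)) = 0 := by
    have h := congrArg (fun w ↦ inner ℝ w (S.φ x (U x))) cod
    simp only [inner_sub_left, real_inner_smul_left, S.inner_φ_self, mul_zero, sub_zero] at h
    simpa [hx] using h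
  have eW : inner ℝ (nabla (𝓡 3) (fun y ↦ S.φ y (U y)) U x) (S.φ x (U x)) = 0 := by
    have h := congrArg (fun w ↦ inner ℝ w (U x)) cod
    simp only [inner_sub_left, real_inner_smul_left] at h
    have dUU := mvfderiv_inner hU hU hU x
    have dWW := mvfderiv_inner hU hW hW x
    simp only [fun y ↦ S.inner_φ_φ_of_horizontal (hUξ y)] at dWW
    rw [dUU, real_inner_comm _ (U x), real_inner_comm _ (S.φ x (U x))] at dWW
    have h' : inner ℝ (U x) (U x) *
        inner ℝ (nabla (𝓡 3) (fun y ↦ S.φ y (U y)) U x) (S.φ x (U x)) = 0 := by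
      linear_combination (1 / 2) * h - (1 / 2) * inner ℝ (U x) (U x) * dWW
    exact (mul_eq_zero.1 h').resolve_left hUU
  have hXx := congrArg (fun w ↦ inner ℝ (leviCivita (𝓡 3) U x w) (S.φ x (U x)))
    (S.inner_self_smul_eq (hUξ x) (X x))
  simp only [map_add, map_smul, inner_add_left, real_inner_smul_left] at hXx
  change inner ℝ (leviCivita (𝓡 3) U x (S.ξ x)) (S.φ x (U x)) = 0 at eξ
  change inner ℝ (leviCivita (𝓡 3) U x (U x)) (S.φ x (U x)) = 0 at eU
  change inner ℝ (leviCivita (𝓡 3) U x (S.φ x (U x))) (S.φ x (U x)) = 0 at eW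
  rw [eξ, eU, eW, mul_zero, mul_zero, mul_zero, add_zero, add_zero] at hXx
  exact (mul_eq_zero.1 hXx).resolve_left hUU

theorem IsNullity.inner_curvature_φ (hS : S.IsNullity 0) (hU : IsSmoothField U)
    (hUξ : ∀ x, inner ℝ (U x) (S.ξ x) = 0) (hTU : ∀ x, S.nablaξ x (U x) = 0)
    {X Y : Π x : M, TangentSpace (𝓡 3) x} (hX : IsSmoothField X) (hY : IsSmoothField Y) {x : M}
    (hx : U x ≠ 0) : inner ℝ (curvature (𝓡 3) X Y U x) (S.φ x (U x)) = 0 := by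
  have hW := S.smooth_φ_apply hU
  have hUU : (inner ℝ (U x) (U x) : ℝ) ≠ 0 := inner_self_ne_zero.2 hx
  have zero := hS.inner_nabla_φ hU hUξ hTU
  have key : ∀ {A B : Π x : M, TangentSpace (𝓡 3) x}, IsSmoothField A → IsSmoothField B →
      inner ℝ (nabla (𝓡 3) A (nabla (𝓡 3) B U) x) (S.φ x (U x)) = 0 := by
    intro A B hA hB
    have h := mvfderiv_inner hA (S.smooth_nabla hB hU) hW x
    simp only [zero, mvfderiv_const, zero_apply] at h
    have hAU := mvfderiv_inner hA hU hW x
    simp only [S.inner_φ_self, mvfderiv_const, zero_apply, zero, zero_add] at hAU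
    rw [real_inner_comm] at hAU
    have hAξ : inner ℝ (nabla (𝓡 3) A (fun y ↦ S.φ y (U y)) x) (S.ξ x) = 0 := by
      rw [S.inner_nabla_ξ_eq_neg x hA hW fun y ↦ S.inner_φ_ξ y _]
      have := congrArg (fun w ↦ inner ℝ w (S.φ x (U x)))
        (hS.inner_self_smul_nablaξ (hUξ x) (hTU x) (A x))
      simp only [real_inner_smul_left, S.inner_φ_self, mul_zero] at this
      rw [real_inner_comm, (mul_eq_zero.1 this).resolve_left hUU, neg_zero]
    have par := S.inner_self_mul_inner_eq (hUξ x) (nabla (𝓡 3) B U x)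
      (nabla (𝓡 3) A (fun y ↦ S.φ y (U y)) x)
    rw [zero, hAξ, ← hAU, mul_zero, mul_zero, zero_mul, add_zero, add_zero] at par
    rw [(mul_eq_zero.1 par).resolve_left hUU, add_zero] at h
    exact h.symm
  simp only [curvature, Pi.sub_apply, inner_sub_left]
  rw [key hX hY, key hY hX, zero, sub_zero, sub_zero]

end Adapted

theorem IsNullity.isFlat (hS : S.IsNullity 0) : IsFlat M := by
  intro X Y Z hX hY hZ p
  obtain ⟨U, hU, hUp, hUξ, hTU⟩ := hS.exists_nablaξ_eq_zero p
  have hW := S.smooth_φ_apply hU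
  have Rξ := hS.curvature_ξ_eq_zero hX hY p
  have skew := fun {A B : Π x : M, TangentSpace (𝓡 3) x} (hA : IsSmoothField A)
    (hB : IsSmoothField B) ↦ S.inner_curvature_left hX hY hA hB p
  have diag : ∀ {A : Π x : M, TangentSpace (𝓡 3) x}, IsSmoothField A →
      inner ℝ (curvature (𝓡 3) X Y A p) (A p) = 0 := fun hA ↦ by linarith [skew hA hA]
  have perp : ∀ {A : Π x : M, TangentSpace (𝓡 3) x}, IsSmoothField A →
      inner ℝ (curvature (𝓡 3) X Y A p) (S.ξ p) = 0 := fun hA ↦ by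
    rw [skew hA S.smooth_ξ, Rξ, inner_zero_left, neg_zero]
  have hUW := hS.inner_curvature_φ hU hUξ hTU hX hY hUp
  have RU : curvature (𝓡 3) X Y U p = 0 :=
    S.eq_zero_of_inner_frame hUp (hUξ p) (perp hU) (diag hU) hUW
  have RW : curvature (𝓡 3) X Y (fun y ↦ S.φ y (U y)) p = 0 :=
    S.eq_zero_of_inner_frame hUp (hUξ p) (perp hW) (by rw [skew hW hU, hUW, neg_zero]) (diag hW)
  refine S.eq_zero_of_inner_frame hUp (hUξ p) (perp hZ) ?_ ?_
  · rw [skew hZ hU, RU, inner_zero_left, neg_zero]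
  · rw [skew hZ hW, RW, inner_zero_left, neg_zero]

theorem IsPhiRecurrent.nullity_eq_zero (hR : S.IsPhiRecurrent) {k : ℝ} (hS : S.IsNullity k) :
    k = 0 := by
  obtain ⟨A, -, ⟨p, hp⟩, hA⟩ := hR
  obtain ⟨w, hw⟩ : ∃ w, A p w ≠ 0 := by
    by_contra! h
    exact hp (ContinuousLinearMap.ext h)
  obtain ⟨W, hW, rfl⟩ := exists_isSmoothField_eq p w
  obtain ⟨v, hvξ, hv⟩ := S.exists_unit_horizontal p
  obtain ⟨V, hV, rfl⟩ := exists_isSmoothField_eq p v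
  have h := congrArg (fun u ↦ inner ℝ u (S.ξ p)) (hA W V S.ξ V hW hV S.smooth_ξ hV p)
  simp only [S.inner_φ_φ_ξ, real_inner_smul_left] at h
  have h' := (mul_eq_zero.1 h.symm).resolve_left hw
  rw [S.inner_curvature_left hV S.smooth_ξ hV S.smooth_ξ, hS.curvature_ξ hV S.smooth_ξ,
    inner_ξ_ξ, hvξ, zero_smul, one_smul, sub_zero, real_inner_smul_left, hv] at h'
  linarith

theorem nablaCurvature_eq_zero_of_isFlat (S : ContactMetricStructure M) (hM : IsFlat M)
    {W X Y Z : Π x : M, TangentSpace (𝓡 3) x} (hW : IsSmoothField W) (hX : IsSmoothField X)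
    (hY : IsSmoothField Y) (hZ : IsSmoothField Z) : nablaCurvature (𝓡 3) W X Y Z = 0 := by
  have h0 : ∀ {A B C : Π x : M, TangentSpace (𝓡 3) x}, IsSmoothField A → IsSmoothField B →
      IsSmoothField C → curvature (𝓡 3) A B C = 0 := fun hA hB hC ↦ funext (hM _ _ _ hA hB hC)
  rw [nablaCurvature, h0 hX hY hZ, h0 (S.smooth_nabla hW hX) hY hZ,
    h0 hX (S.smooth_nabla hW hY) hZ, h0 hX hY (S.smooth_nabla hW hZ), nabla_zero]
  simp

theorem isPhiRecurrent_of_isFlat [Nonempty M] (hM : IsFlat M) : S.IsPhiRecurrent := by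
  obtain ⟨p⟩ : Nonempty M := inferInstance
  refine ⟨S.η, S.smooth_η, ⟨p, fun h ↦ by simpa [h] using S.η_ξ p⟩,
    fun W X Y Z hW hX hY hZ x ↦ ?_⟩
  rw [S.nablaCurvature_eq_zero_of_isFlat hM hW hX hY hZ, hM X Y Z hX hY hZ]
  simp

end ContactMetricStructure

theorem theorem3p4 {M : Type*} [TopologicalSpace M] [T2Space M] [SecondCountableTopology M]
    [Nonempty M] [ChartedSpace (EuclideanSpace ℝ (Fin 3)) M] [IsManifold (𝓡 3) ∞ M]
    [RiemannianBundle (fun x : M ↦ TangentSpace (𝓡 3) x)]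
    [IsContMDiffRiemannianBundle (𝓡 3) ∞ (EuclideanSpace ℝ (Fin 3))
      (fun x : M ↦ TangentSpace (𝓡 3) x)]
    (S : ContactMetricStructure M) :
    ((∃ k : ℝ, S.IsNullity k) ∧ S.IsPhiRecurrent) ↔ IsFlat M := by
  constructor
  · rintro ⟨⟨k, hk⟩, hR⟩
    obtain rfl := hR.nullity_eq_zero hk
    exact hk.isFlat
  · exact fun hM ↦ ⟨⟨0, ContactMetricStructure.isNullity_zero_of_isFlat hM⟩,
      ContactMetricStructure.isPhiRecurrent_of_isFlat hM⟩
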